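/- Let $N$ be a number of players and let player $i\in\Lambda=\{1,\dots,N\}$ choose a strategy in $\mathbb R^{n_i}$, $n_i\ge 1$; put $n=\sum_i n_i$, give $\mathbb R^n=\prod_i\mathbb R^{n_i}$ the Euclidean norm, and write $\bar B(0,r)$ for the closed ball. Let $\mathcal X\subseteq\mathbb R^n$ be nonempty, closed and convex, let $X_i$ be the projection of $\mathcal X$ on $\mathbb R^{n_i}$, $X=\prod_i X_i$, and let $K_i(x)=\{z_i\in X_i : (x_{-i},z_i)\in\mathcal X\}$ for $x\in X$, where $(x_{-i},z_i)$ is $x$ with its $i$-th strategy replaced by $z_i$. Let $P_i:X\rightrightarrows X_i$, $i\in\Lambda$, be multi-valued maps. An equilibrium of the jointly convex generalized Nash game $\Gamma'=(\mathcal X,K_i,P_i)_{i\in\Lambda}$ is a point $\tilde x\in X$ such that $\tilde x_i\in K_i(\tilde x)$ and $P_i(\tilde x)\cap K_i(\tilde x)=\emptyset$ for every $i\in\Lambda$. Assume: (a) for each $i$, the map $P_i$ is lower semicontinuous on $X$, each $P_i(x)$ is open in $X_i$, and $x_i\notin co(P_i(x))$ for all $x\in X$; (b) there is $\rho>0$ such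 that for each $x\in\mathcal X\setminus\bar B(0,\rho)$ there is $z\in\mathcal X$ with $\|z\|<\|x\|$ and $z_i\in P_i(x)$ for every $i\in\Lambda$; (c) there is $\rho'>\rho$ with $\mathcal X\cap\bar B(0,\rho')\ne\emptyset$. Then $\Gamma'$ has an equilibrium. Moreover, let $T(x)=\prod_i T_i(x)$ with $$T_i(x)=co\bigl(\{v\in\mathbb R^{n_i} : \|v\|=1,\ \langle v,z-x_i\rangle\le 0\ \text{for all } z\in co(P_i(x))\}\bigr).$$ Then $VI(T,\mathcal X)$ has a solution, i.e. there are $\bar x\in\mathcal X$ and $\bar x^*\in T(\bar x)$ with $\langle\bar x^*,y-\bar x\rangle\ge 0$ for all $y\in\mathcal X$. If in addition every $P_i(x)$, $x\in X$, is open in $\mathbb R^{n_i}$, then every solution $\bar x$ of $VI(T,\mathcal X)$ is an equilibrium of $\Gamma'$. -/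

import Mathlib

namespace PreferenceGNEP

/-- The Euclidean space `ℝ^{n_1} × ⋯ × ℝ^{n_N} = ℝ^n` of strategy vectors `x = (x_1, …, x_N)`,
with its Euclidean norm and inner product; `x i` is the strategy of player `i`. -/
abbrev Profile {N : ℕ} (n : Fin N → ℕ) : Type :=
  PiLp 2 (fun i => EuclideanSpace ℝ (Fin (n i)))

/-- The normal cone of `C` at `x`; it is the whole space when `C` is empty. -/
def normalCone {E : Type*} [NormedAddCommGroup E] [InnerProductSpace ℝ E]
    (C : Set E) (x : E) : Set E :=
  {v | ∀ z ∈ C, inner ℝ v (z - x) ≤ 0}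

/-- `x` solves the Stampacchia variational inequality `VI(T, K)`. -/
def SolvesVI {E : Type*} [NormedAddCommGroup E] [InnerProductSpace ℝ E]
    (T : E → Set E) (K : Set E) (x : E) : Prop :=
  x ∈ K ∧ ∃ v ∈ T x, ∀ z ∈ K, 0 ≤ inner ℝ v (z - x)

variable {N : ℕ} {n : Fin N → ℕ}

/-- The vector `(x_{-i}, z)`: the `i`-th strategy of `x` is replaced by `z`. -/
def deviate (x : Profile n) (i : Fin N) (z : EuclideanSpace ℝ (Fin (n i))) : Profile n :=
  WithLp.toLp 2 (Function.update (fun j => x j) i z)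

/-- The product `X = ∏ X_i` of the choice sets. -/
def productSet (X : ∀ i, Set (EuclideanSpace ℝ (Fin (n i)))) : Set (Profile n) :=
  {x | ∀ i, x i ∈ X i}

/-- Equilibrium of the abstract economy `(X_i, K_i, P_i)`. -/
def IsEquilibrium (X : ∀ i, Set (EuclideanSpace ℝ (Fin (n i))))
    (K P : ∀ i, Profile n → Set (EuclideanSpace ℝ (Fin (n i)))) (x : Profile n) : Prop :=
  x ∈ productSet X ∧ ∀ i, x i ∈ K i x ∧ P i x ∩ K i x = ∅

/-- The choice set of player `i` in the jointly convex game: the projection of the joint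
constraint set on `ℝ^{n_i}`. -/
def choiceSet (S : Set (Profile n)) (i : Fin N) : Set (EuclideanSpace ℝ (Fin (n i))) :=
  (fun x : Profile n => x i) '' S

/-- The constraint map `K_i(x) = {z ∈ X_i | (x_{-i}, z) ∈ S}` of the jointly convex game. -/
def constraintMap (S : Set (Profile n)) (i : Fin N) (x : Profile n) :
    Set (EuclideanSpace ℝ (Fin (n i))) :=
  {z | z ∈ choiceSet S i ∧ deviate x i z ∈ S}

/-- `T_i(x) = co(N_{co P_i(x)}(x_i) ∩ S_i[0,1])`, where `S_i[0,1]` is the unit sphere. -/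
def playerOperator (P : ∀ i, Profile n → Set (EuclideanSpace ℝ (Fin (n i)))) (i : Fin N)
    (x : Profile n) : Set (EuclideanSpace ℝ (Fin (n i))) :=
  convexHull ℝ (normalCone (convexHull ℝ (P i x)) (x i) ∩ Metric.sphere 0 1)

/-- `T(x) = ∏ T_i(x)`. -/
def gameOperator (P : ∀ i, Profile n → Set (EuclideanSpace ℝ (Fin (n i))))
    (x : Profile n) : Set (Profile n) :=
  {v | ∀ i, v i ∈ playerOperator P i x}

/-- Upper sections of a preference map `X → 2^A` are open: for each `x ∈ X`, the set `P x` is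
open in the choice set `A` (in the subspace topology). -/
def HasOpenUpperSections {E F : Type*} [TopologicalSpace F]
    (P : E → Set F) (X : Set E) (A : Set F) : Prop :=
  ∀ x ∈ X, ∃ U : Set F, IsOpen U ∧ P x = U ∩ A

end PreferenceGNEP

/-! ### No smooth retraction of a ball onto its sphere. -/

section Brouwer

open Set Metric MeasureTheory Module

variable {E : Type*} [NormedAddCommGroup E] [InnerProductSpace ℝ E] [FiniteDimensional ℝ E]

/-! Compactness of the unit normals and lower semicontinuity of `P` give a variational inequality on
a ball a solution, by Sion's minimax theorem and Brouwer's theorem (proved here by a volume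
argument). Condition (b) removes the ball: at a solution on its boundary sphere, the coercivity
point lies strictly inside and is no worse than the solution. With plain unit normals this solves
`VI(T, S)`.

A deviation `z` in `P i x` and `K_i` forces `⟪v i, z - x i⟫ ≥ 0`. If `P i x` is open in the whole
space, nonzero normals are strictly negative on `z - x i`, so every solution is an equilibrium. If
`P i x` is only relatively open, equality may occur, but then the generators of `v i` are normal to
all of `X_i`. To exclude this case, take `a ∈ S` with each `a i` relatively interior to `X_i`,
restrict the normals `u` to the direction space of `X_i`, and stretch each by `1 + L * max 0 (-⟪u, a
i - x i⟫)`. Normals to all of `X_i` then pair so negatively with `a i - x i` that the bounded terms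
of the other players cannot compensate, against the inequality tested at `a`. The core is
`exists_solution_stretchedNormals` with `inner_neg_or_of_mem_convexHull_stretchedNormals`. -/

theorem exists_polynomial_det_one_add_smul (A : E →L[ℝ] E) :
    ∃ p : Polynomial ℝ, p.natDegree ≤ finrank ℝ E ∧ ∀ t : ℝ, (1 + t • A : E →L[ℝ] E).det = p.eval t := by
  let b := Module.finBasis ℝ E
  let M := LinearMap.toMatrix b b (A : E →ₗ[ℝ] E)
  refine ⟨((Polynomial.X : Polynomial ℝ) • M.map Polynomial.C
    + (1 : Matrix (Fin (finrank ℝ E)) (Fin (finrank ℝ E)) ℝ).map Polynomial.C).det, ?_, fun t => ?_⟩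
  · simpa using Polynomial.natDegree_det_X_add_C_le M 1
  · rw [ContinuousLinearMap.det, ← LinearMap.det_toMatrix b, ← Polynomial.coe_evalRingHom,
      RingHom.map_det]
    congr 1
    ext i j
    by_cases hij : i = j
    · subst hij
      simp [M, LinearMap.toMatrix_apply]; ring
    · simp [M, LinearMap.toMatrix_apply, hij]; ring

/-- The determinant equals 1 at the identity and cannot vanish along `1 + s • A`, invertible by the
Neumann series. -/
theorem det_one_add_pos {A : E →L[ℝ] E} (hA : ‖A‖ < 1) : 0 < (1 + A : E →L[ℝ] E).det := by
  have hne : ∀ s ∈ Icc (0 : ℝ) 1, (1 + s • A : E →L[ℝ] E).det ≠ 0 := by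
    intro s hs
    have h1 : ‖-(s • A)‖ < 1 := by
      rw [norm_neg, norm_smul, Real.norm_of_nonneg hs.1]
      nlinarith [norm_nonneg A, hs.2]
    have h2 := isUnit_one_sub_of_norm_lt_one h1
    rw [sub_neg_eq_add] at h2
    have h3 : IsUnit ((1 + s • A : E →L[ℝ] E) : E →ₗ[ℝ] E) :=
      h2.map (ContinuousLinearMap.toLinearMapRingHom : (E →L[ℝ] E) →+* (E →ₗ[ℝ] E))
    exact (LinearMap.isUnit_iff_isUnit_det _).1 h3 |>.ne_zero
  have hc : ContinuousOn (fun s : ℝ => (1 + s • A : E →L[ℝ] E).det) (Icc 0 1) :=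
    (ContinuousLinearMap.continuous_det.comp (by fun_prop)).continuousOn
  by_contra hcon
  rw [not_lt] at hcon
  have h0 : (0 : ℝ) ∈ Icc ((1 + (1 : ℝ) • A : E →L[ℝ] E).det) ((1 + (0 : ℝ) • A : E →L[ℝ] E).det) := by
    refine ⟨by simpa using hcon, ?_⟩
    have : (1 + (0 : ℝ) • A : E →L[ℝ] E).det = 1 := by
      simp [ContinuousLinearMap.det, ContinuousLinearMap.one_def]
    rw [this]; norm_num
  obtain ⟨s, hs, hs0⟩ := intermediate_value_Icc' (zero_le_one) hc h0
  exact hne s hs hs0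

theorem surjective_of_det_ne_zero {A : E →L[ℝ] E} (hA : A.det ≠ 0) :
    (A : E →ₗ[ℝ] E).range = ⊤ := by
  have h : IsUnit (A : E →ₗ[ℝ] E) := (LinearMap.isUnit_iff_isUnit_det _).2 (isUnit_iff_ne_zero.2 hA)
  exact LinearMap.isUnit_iff_range_eq_top _ |>.1 h

theorem det_eq_zero_of_inner_eq_zero {A : E →L[ℝ] E} {w : E} (hw : w ≠ 0)
    (h : ∀ v, inner ℝ (A v) w = 0) : A.det = 0 := by
  by_contra hA
  have := surjective_of_det_ne_zero hA
  obtain ⟨v, hv⟩ := LinearMap.range_eq_top.1 this w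
  have h1 := h v
  rw [show A v = w from hv] at h1
  exact hw (inner_self_eq_zero.1 h1)

section Retraction

variable {r : E → E} {R C : ℝ}

/-- The image is open by the inverse function theorem and relatively closed in the ball, since
boundary points are fixed and so never land inside; connectedness of the ball concludes. -/
theorem image_ball_eq_of_homotopy_small
    (hr : ∀ x ∈ closedBall 0 R, ContDiffAt ℝ 1 r x) (hR : 0 < R)
    (hn : ∀ x ∈ closedBall 0 R, ‖r x‖ = R) (hfix : ∀ x ∈ sphere 0 R, r x = x)
    (hC : ∀ x ∈ closedBall 0 R, ‖fderiv ℝ r x - 1‖ ≤ C) {t : ℝ} (ht : 0 ≤ t) (ht1 : t < 1)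
    (htC : t * C < 1) :
    (fun x => x + t • (r x - x)) '' ball 0 R = ball 0 R := by
  set f : E → E := fun x => x + t • (r x - x) with hf
  have hfe : ∀ x, f x = (1 - t) • x + t • r x := fun x => by simp only [hf]; module
  have hmaps : f '' ball 0 R ⊆ ball 0 R := by
    rintro _ ⟨x, hx, rfl⟩
    have hx' := hn x (ball_subset_closedBall hx)
    rw [mem_ball_zero_iff] at hx ⊢
    rw [hfe]
    calc ‖(1 - t) • x + t • r x‖ ≤ ‖(1 - t) • x‖ + ‖t • r x‖ := norm_add_le _ _
      _ = (1 - t) * ‖x‖ + t * R := by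
        rw [norm_smul, norm_smul, hx', Real.norm_of_nonneg ht, Real.norm_of_nonneg (by linarith)]
      _ < (1 - t) * R + t * R := by
        have := mul_lt_mul_of_pos_left hx (by linarith : 0 < 1 - t); linarith
      _ = R := by ring
  have hfd : ∀ x ∈ closedBall 0 R, ContDiffAt ℝ 1 f x := fun x hx =>
    contDiffAt_id.add (((hr x hx).sub contDiffAt_id).const_smul t)
  have hfderiv : ∀ x ∈ closedBall 0 R, HasFDerivAt f (1 + t • (fderiv ℝ r x - 1)) x := by
    intro x hx
    have h1 := ((hr x hx).differentiableAt (by simp)).hasFDerivAt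
    exact (hasFDerivAt_id x).add ((h1.sub (hasFDerivAt_id x)).const_smul t)
  have hopen : IsOpen (f '' ball 0 R) := by
    rw [isOpen_iff_mem_nhds]
    rintro _ ⟨x, hx, rfl⟩
    have hx' := ball_subset_closedBall hx
    have hs : HasStrictFDerivAt f (1 + t • (fderiv ℝ r x - 1)) x :=
      (hfd x hx').hasStrictFDerivAt' (hfderiv x hx') (by simp)
    have hdet : (1 + t • (fderiv ℝ r x - 1) : E →L[ℝ] E).det ≠ 0 := by
      refine (det_one_add_pos ?_).ne'
      rw [norm_smul, Real.norm_of_nonneg ht]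
      exact (mul_le_mul_of_nonneg_left (hC x hx') ht).trans_lt htC
    rw [← hs.map_nhds_eq_of_surj (surjective_of_det_ne_zero hdet)]
    exact Filter.image_mem_map (isOpen_ball.mem_nhds hx)
  have hcont : ContinuousOn f (closedBall 0 R) := fun x hx =>
    (hfd x hx).continuousAt.continuousWithinAt
  have hclosed : IsClosed (f '' closedBall 0 R) :=
    ((isCompact_closedBall 0 R).image_of_continuousOn hcont).isClosed
  refine hmaps.antisymm ?_
  refine IsPreconnected.subset_left_of_subset_union hopen hclosed.isOpen_compl ?_ ?_ ?_
    (convex_ball (0 : E) R).isPreconnected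
  · exact Set.disjoint_compl_right_iff_subset.2 (image_mono ball_subset_closedBall)
  · intro y hy
    by_cases hyc : y ∈ f '' closedBall 0 R
    · obtain ⟨x, hx, rfl⟩ := hyc
      left
      rcases (mem_closedBall_zero_iff.1 hx).lt_or_eq with h | h
      · exact ⟨x, mem_ball_zero_iff.2 h, rfl⟩
      · exfalso
        have : f x = x := by simp [hf, hfix x (mem_sphere_zero_iff_norm.2 h)]
        rw [this, mem_ball_zero_iff] at hy
        exact hy.ne h
    · exact Or.inr hyc
  · exact ⟨f 0, hmaps ⟨0, mem_ball_self hR, rfl⟩, 0, mem_ball_self hR, rfl⟩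

/-- Change of variables: `r - id` is `C`-Lipschitz, so `t * C < 1` makes the homotopy injective, and
its Jacobian is positive. -/
theorem integral_det_homotopy_small [MeasurableSpace E] [BorelSpace E]
    (hr : ∀ x ∈ closedBall 0 R, ContDiffAt ℝ 1 r x) (hR : 0 < R)
    (hn : ∀ x ∈ closedBall 0 R, ‖r x‖ = R) (hfix : ∀ x ∈ sphere 0 R, r x = x)
    (hC : ∀ x ∈ closedBall 0 R, ‖fderiv ℝ r x - 1‖ ≤ C) {t : ℝ} (ht : 0 ≤ t) (ht1 : t < 1)
    (htC : t * C < 1) :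
    ∫ x in ball 0 R, (1 + t • (fderiv ℝ r x - 1) : E →L[ℝ] E).det
      = (volume : Measure E).real (ball 0 R) := by
  have himg := image_ball_eq_of_homotopy_small hr hR hn hfix hC ht ht1 htC
  have hrd : ∀ x ∈ closedBall 0 R, HasFDerivAt (fun x => r x - x) (fderiv ℝ r x - 1) x :=
    fun x hx => ((hr x hx).differentiableAt (by simp)).hasFDerivAt.sub (hasFDerivAt_id x)
  have hfderiv : ∀ x ∈ ball 0 R, HasFDerivWithinAt (fun x => x + t • (r x - x))
      (1 + t • (fderiv ℝ r x - 1)) (ball 0 R) x := fun x hx =>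
    ((hasFDerivAt_id x).add
      ((hrd x (ball_subset_closedBall hx)).const_smul t)).hasFDerivWithinAt
  have hinj : InjOn (fun x => x + t • (r x - x)) (ball 0 R) := by
    intro x hx y hy hxy
    have h1 : ‖(r y - y) - (r x - x)‖ ≤ C * ‖y - x‖ :=
      (convex_closedBall (0 : E) R).norm_image_sub_le_of_norm_hasFDerivWithin_le
        (fun z hz => (hrd z hz).hasFDerivWithinAt) hC (ball_subset_closedBall hx)
        (ball_subset_closedBall hy)
    have h2 : y - x = -(t • ((r y - y) - (r x - x))) := by
      have h3 : x + t • (r x - x) - (y + t • (r y - y)) = 0 := sub_eq_zero.2 hxy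
      linear_combination (norm := module) (-1 : ℝ) • h3
    have h4 : ‖y - x‖ ≤ t * C * ‖y - x‖ := by
      calc ‖y - x‖ = t * ‖(r y - y) - (r x - x)‖ := by
            conv_lhs => rw [h2, norm_neg, norm_smul, Real.norm_of_nonneg ht]
        _ ≤ t * (C * ‖y - x‖) := mul_le_mul_of_nonneg_left h1 ht
        _ = _ := by ring
    have h5 : ‖y - x‖ = 0 := by nlinarith [norm_nonneg (y - x)]
    exact (sub_eq_zero.1 (norm_eq_zero.1 h5)).symm
  have := integral_image_eq_integral_abs_det_fderiv_smul (volume : Measure E)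
    measurableSet_ball hfderiv hinj (fun _ => (1 : ℝ))
  rw [himg] at this
  simp only [integral_const, smul_eq_mul, mul_one, measureReal_restrict_apply_univ] at this
  rw [this]
  refine setIntegral_congr_fun measurableSet_ball fun x hx => ?_
  refine (abs_of_pos (det_one_add_pos ?_)).symm
  rw [norm_smul, Real.norm_of_nonneg ht]
  exact (mul_le_mul_of_nonneg_left (hC x (ball_subset_closedBall hx)) ht).trans_lt htC

/-- There is no `C¹` retraction of a closed ball onto its boundary sphere. -/
theorem not_contDiff_retraction
    (hr : ∀ x ∈ closedBall 0 R, ContDiffAt ℝ 1 r x) (hR : 0 < R)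
    (hn : ∀ x ∈ closedBall 0 R, ‖r x‖ = R) (hfix : ∀ x ∈ sphere 0 R, r x = x) : False := by
  borelize E
  have hcd : ContinuousOn (fun x => fderiv ℝ r x - 1) (closedBall 0 R) := fun x hx =>
    (((hr x hx).fderiv_right (m := 0) (by simp)).continuousAt.sub
      continuousAt_const).continuousWithinAt
  obtain ⟨C, hC⟩ := (isCompact_closedBall (0 : E) R).exists_bound_of_continuousOn hcd
  have hC0 : 0 ≤ C := (norm_nonneg _).trans (hC 0 (mem_closedBall_self hR.le))
  set d := finrank ℝ E
  let s := Finset.range (d + 1)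
  -- These are `d + 1` distinct times, small enough that `v j < 1` and `v j * C < 1`.
  let v : ℕ → ℝ := fun j => (j : ℝ) / ((d + 1) * (C + 1))
  have hd : (0 : ℝ) < (d + 1) * (C + 1) := by positivity
  have hv : InjOn v s := fun i _ j _ hij => by
    have := (div_left_inj' hd.ne').1 hij
    exact_mod_cast this
  have hvol : ∀ j ∈ s, ∫ x in ball 0 R, (1 + v j • (fderiv ℝ r x - 1) : E →L[ℝ] E).det
      = (volume : Measure E).real (ball 0 R) := by
    intro j hj
    have hj' : (j : ℝ) < d + 1 := by exact_mod_cast Finset.mem_range.1 hj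
    have h1 : v j * (C + 1) < 1 := by
      simp only [v]
      rw [div_mul_eq_mul_div, div_lt_one hd]
      nlinarith
    have h0 : 0 ≤ v j := by positivity
    exact integral_det_homotopy_small hr hR hn hfix hC h0 (by nlinarith) (by nlinarith)
  have hint : ∀ c : ℝ, IntegrableOn (fun x => (1 + c • (fderiv ℝ r x - 1) : E →L[ℝ] E).det)
      (ball 0 R) := fun c =>
    ((ContinuousLinearMap.continuous_det.comp_continuousOn
      (continuousOn_const.add (hcd.const_smul c))).integrableOn_compact
        (isCompact_closedBall 0 R)).mono_set ball_subset_closedBall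
  -- The determinant has degree at most `d` in `t`, so its value at `t = 1` is extrapolated from
  -- small times, with weights independent of `x`.
  have hlag : ∀ x, (fderiv ℝ r x).det = ∑ j ∈ s, (Lagrange.basis s v j).eval 1 *
      (1 + v j • (fderiv ℝ r x - 1) : E →L[ℝ] E).det := by
    intro x
    obtain ⟨p, hp, hpe⟩ := exists_polynomial_det_one_add_smul (fderiv ℝ r x - 1)
    have h1 : p = Lagrange.interpolate s v fun i => p.eval (v i) := by
      refine Lagrange.eq_interpolate hv ?_
      rw [Finset.card_range]
      exact Polynomial.degree_le_natDegree.trans_lt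
        (by exact_mod_cast Nat.lt_succ_of_le hp)
    have h2 : (fderiv ℝ r x).det = p.eval 1 := by rw [← hpe]; simp
    rw [h2, h1, Lagrange.interpolate_apply, Polynomial.eval_finsetSum]
    refine Finset.sum_congr rfl fun j _ => ?_
    rw [hpe]
    simp [mul_comm]
  -- Differentiating `‖r‖ ^ 2 = R ^ 2` shows that the range of the derivative is orthogonal to `r
  -- x`.
  have hzero : ∀ x ∈ ball 0 R, (fderiv ℝ r x).det = 0 := by
    intro x hx
    have hx' := ball_subset_closedBall hx
    refine det_eq_zero_of_inner_eq_zero (w := r x) ?_ fun u => ?_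
    · intro h; have := hn x hx'; rw [h, norm_zero] at this; exact hR.ne this
    · have hd := ((hr x hx').differentiableAt (by simp)).hasFDerivAt
      have h1 : HasFDerivAt (fun y => inner ℝ (r y) (r y)) _ x := hd.inner ℝ hd
      have h2 : (fun y => inner ℝ (r y) (r y)) =ᶠ[nhds x] fun _ => R ^ 2 := by
        filter_upwards [isOpen_ball.mem_nhds hx] with y hy
        rw [real_inner_self_eq_norm_sq, hn y (ball_subset_closedBall hy)]
      have h3 := h1.unique ((hasFDerivAt_const (R ^ 2) x).congr_of_eventuallyEq h2)
      have h4 := congrArg (fun L : E →L[ℝ] ℝ => L u) h3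
      simp [fderivInnerCLM_apply, real_inner_comm] at h4
      rw [real_inner_comm] at h4
      linarith
  have hV : (0 : ℝ) < (volume : Measure E).real (ball 0 R) :=
    ENNReal.toReal_pos (measure_ball_pos _ _ hR).ne' measure_ball_lt_top.ne
  have h0 : ∫ x in ball 0 R, (fderiv ℝ r x).det = 0 :=
    setIntegral_eq_zero_of_forall_eq_zero hzero
  simp_rw [hlag] at h0
  rw [integral_finsetSum _ fun j _ => (hint (v j)).const_mul _] at h0
  simp_rw [integral_const_mul] at h0
  -- The Lagrange weights sum to 1, so the volume of the ball would be 0.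
  rw [Finset.sum_congr rfl fun j hj => by rw [hvol j hj], ← Finset.sum_mul,
    ← Polynomial.eval_finsetSum, Lagrange.sum_basis hv ⟨0, by simp [s]⟩] at h0
  simp at h0
  exact hV.ne' h0

end Retraction

end Brouwer

/-! ### Brouwer's fixed point theorem. -/

section FixedPoint

open Set Metric

variable {E : Type*} [NormedAddCommGroup E] [InnerProductSpace ℝ E] [FiniteDimensional ℝ E]

/-- Without a fixed point, following the ray from `f x` through `x` to the sphere is a smooth
retraction. Here `t` is the larger root of `‖x + t • u x‖ ^ 2 = R ^ 2`; the gap `R₀ < R` keeps the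
discriminant positive up to the sphere, where `t` vanishes. -/
theorem exists_fixedPoint_of_contDiff {f : E → E} (hf : ContDiff ℝ 1 f) {R₀ R : ℝ} (hR₀ : 0 ≤ R₀)
    (hlt : R₀ < R) (hb : ∀ x, ‖f x‖ ≤ R₀) : ∃ x, f x = x := by
  by_contra! hne
  have hR : 0 < R := hR₀.trans_lt hlt
  let u : E → E := fun x => x - f x
  let a : E → ℝ := fun x => ‖u x‖ ^ 2
  let b : E → ℝ := fun x => inner ℝ x (u x)
  let c : E → ℝ := fun x => R ^ 2 - ‖x‖ ^ 2
  let D : E → ℝ := fun x => b x ^ 2 + a x * c x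
  let t : E → ℝ := fun x => (-b x + √(D x)) / a x
  have hu : ContDiff ℝ 1 u := contDiff_id.sub hf
  have ha : ContDiff ℝ 1 a := hu.norm_sq ℝ
  have hbc : ContDiff ℝ 1 b := contDiff_id.inner ℝ hu
  have hc : ContDiff ℝ 1 c := contDiff_const.sub (contDiff_id.norm_sq ℝ)
  have hD : ContDiff ℝ 1 D := (hbc.pow 2).add (ha.mul hc)
  have ha0 : ∀ x, 0 < a x := fun x =>
    pow_pos (norm_pos_iff.2 (sub_ne_zero.2 (hne x).symm)) 2
  have hbpos : ∀ x, ‖x‖ = R → 0 < b x := by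
    intro x hx
    have h1 : b x = R ^ 2 - inner ℝ x (f x) := by
      simp only [b, u, inner_sub_right, real_inner_self_eq_norm_sq, hx]
    have h2 : inner ℝ x (f x) ≤ R * R₀ :=
      (real_inner_le_norm _ _).trans (by rw [hx]; exact mul_le_mul_of_nonneg_left (hb x) hR.le)
    rw [h1]; nlinarith
  have hDpos : ∀ x ∈ closedBall (0 : E) R, 0 < D x := by
    intro x hx
    rcases (mem_closedBall_zero_iff.1 hx).lt_or_eq with h | h
    · have h1 : 0 < c x := by
        simp only [c]; nlinarith [norm_nonneg x]
      have := mul_pos (ha0 x) h1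
      positivity
    · have h1 : c x = 0 := by simp [c, h]
      have := hbpos x h
      simp only [D, h1]; positivity
  refine not_contDiff_retraction (r := fun x => x + t x • u x) (R := R) (fun x hx => ?_) hR
    (fun x hx => ?_) fun x hx => ?_
  · have ht : ContDiffAt ℝ 1 t x :=
      (hbc.contDiffAt.neg.add (hD.contDiffAt.sqrt (hDpos x hx).ne')).div ha.contDiffAt (ha0 x).ne'
    exact contDiffAt_id.add (ht.smul hu.contDiffAt)
  · have h1 : t x * a x = -b x + √(D x) := div_mul_cancel₀ _ (ha0 x).ne'
    have h2 : √(D x) ^ 2 = D x := Real.sq_sqrt (hDpos x hx).le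
    have h3 : ‖x + t x • u x‖ ^ 2 = ‖x‖ ^ 2 + 2 * (t x * b x) + t x ^ 2 * a x := by
      rw [norm_add_sq_real, inner_smul_right, norm_smul, mul_pow, Real.norm_eq_abs, sq_abs]
    have h4 : a x * (t x ^ 2 * a x + 2 * (t x * b x) - c x) = 0 := by
      have : (t x * a x + b x) ^ 2 = b x ^ 2 + a x * c x := by
        rw [h1, neg_add_cancel_comm, h2]
      linear_combination this
    have h5 := (mul_eq_zero.1 h4).resolve_left (ha0 x).ne'
    have h6 : ‖x + t x • u x‖ ^ 2 = R ^ 2 := by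
      rw [h3]; simp only [c] at h5; linarith
    exact (pow_left_inj₀ (norm_nonneg _) hR.le two_ne_zero).1 h6
  · have hx' := mem_sphere_zero_iff_norm.1 hx
    have h1 : t x = 0 := by
      simp only [t, D, c, hx', sub_self, mul_zero, add_zero, Real.sqrt_sq (hbpos x hx').le,
        neg_add_cancel, zero_div]
    simp [h1]

/-- A smooth map closer to `f` than the least displacement of `f` on a large ball would have a fixed
point that `f` moves by less than this minimum. -/
theorem exists_fixedPoint_of_bounded {f : E → E} (hf : Continuous f) {R : ℝ}
    (hb : ∀ x, ‖f x‖ ≤ R) : ∃ x, f x = x := by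
  by_contra! hne
  have hR : 0 ≤ R := (norm_nonneg _).trans (hb 0)
  obtain ⟨x₀, -, hx₀⟩ := (isCompact_closedBall (0 : E) (R + 1)).exists_isMinOn
    ⟨0, mem_closedBall_self (by linarith)⟩ (f := fun x => ‖f x - x‖)
    (by fun_prop : Continuous fun x => ‖f x - x‖).continuousOn
  have hpos : 0 < ‖f x₀ - x₀‖ := norm_pos_iff.2 (sub_ne_zero.2 (hne x₀))
  obtain ⟨g, hg, hgf, -⟩ := hf.exists_contDiff_approx (ε := fun _ => min ‖f x₀ - x₀‖ 1) 1
    continuous_const fun _ => lt_min hpos one_pos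
  have hgb : ∀ x, ‖g x‖ ≤ R + 1 := fun x => by
    have h1 := (hgf x).trans_le (min_le_right _ _)
    rw [dist_eq_norm] at h1
    have h2 := norm_le_norm_add_norm_sub' (g x) (f x)
    linarith [hb x]
  obtain ⟨x, hx⟩ := exists_fixedPoint_of_contDiff hg (by linarith) (lt_add_one (R + 1)) hgb
  have h1 : ‖f x₀ - x₀‖ ≤ ‖f x - x‖ :=
    isMinOn_iff.1 hx₀ x (mem_closedBall_zero_iff.2 (hx ▸ hgb x))
  have h2 := (hgf x).trans_le (min_le_left _ _)
  rw [hx, dist_comm, dist_eq_norm] at h2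
  linarith

/-- The metric projection works: adding its variational inequalities at two points shows that it is
1-Lipschitz. -/
theorem exists_continuous_retraction_of_convex {K : Set E} (hne : K.Nonempty) (hK : IsClosed K)
    (hconv : Convex ℝ K) : ∃ p : E → E, Continuous p ∧ (∀ x, p x ∈ K) ∧ ∀ x ∈ K, p x = x := by
  choose p hpK hp using exists_norm_eq_iInf_of_complete_convex hne hK.isComplete hconv
  have hp' : ∀ x, ∀ w ∈ K, inner ℝ (x - p x) (w - p x) ≤ 0 := fun x =>
    (norm_eq_iInf_iff_real_inner_le_zero hconv (hpK x)).1 (hp x)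
  refine ⟨p, ?_, hpK, fun x hx => ?_⟩
  · refine (LipschitzWith.of_dist_le_mul (K := 1) fun x y => ?_).continuous
    rw [NNReal.coe_one, one_mul, dist_eq_norm, dist_eq_norm]
    have h1 := hp' x (p y) (hpK y)
    have h2 := hp' y (p x) (hpK x)
    have h3 : ‖p x - p y‖ ^ 2 ≤ inner ℝ (x - y) (p x - p y) := by
      rw [← real_inner_self_eq_norm_sq]
      simp only [inner_sub_left, inner_sub_right] at h1 h2 ⊢
      linarith
    have h4 := h3.trans (real_inner_le_norm _ _)
    by_contra! h
    nlinarith [norm_nonneg (x - y)]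
  · have h1 := hp' x x hx
    exact (sub_eq_zero.1 (real_inner_self_nonpos.1 h1)).symm

/-- Brouwer's fixed point theorem for compact convex sets. -/
theorem exists_fixedPoint_of_compact_convex {K : Set E} (hne : K.Nonempty) (hK : IsCompact K)
    (hconv : Convex ℝ K) (f : C(K, E)) (hf : ∀ x, f x ∈ K) : ∃ x : K, f x = x := by
  obtain ⟨p, hpc, hpK, hp⟩ := exists_continuous_retraction_of_convex hne hK.isClosed hconv
  obtain ⟨R, hR⟩ := hK.isBounded.exists_norm_le
  obtain ⟨x, hx⟩ := exists_fixedPoint_of_bounded (f := fun x => f ⟨p x, hpK x⟩)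
    (f.continuous.comp (hpc.subtype_mk hpK)) fun x => hR _ (hf _)
  have hxK : x ∈ K := hx ▸ hf _
  refine ⟨⟨x, hxK⟩, ?_⟩
  simpa only [hp x hxK] using hx

end FixedPoint

/-! ### Variational inequalities on compact convex sets. -/

section VariationalInequality

open Set Module

variable {E : Type*} [NormedAddCommGroup E] [InnerProductSpace ℝ E] [FiniteDimensional ℝ E]

/-- By Carathéodory, `finrank + 1` points suffice, so the hull is a finite union of continuous
images of compact sets. -/
theorem IsCompact.convexHull_of_finiteDimensional {s : Set E} (hs : IsCompact s) :
    IsCompact (convexHull ℝ s) := by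
  let F : (k : ℕ) → (Fin k → ℝ) × (Fin k → E) → E := fun k q => ∑ i, q.1 i • q.2 i
  have hF : ∀ k, Continuous (F k) := fun k => by fun_prop
  have hcomp : IsCompact (⋃ k ∈ Finset.range (finrank ℝ E + 2),
      F k '' (stdSimplex ℝ (Fin k) ×ˢ univ.pi fun _ => s)) :=
    (Finset.range _).isCompact_biUnion fun k _ =>
      ((isCompact_stdSimplex ℝ (Fin k)).prod (isCompact_univ_pi fun _ => hs)).image (hF k)
  convert hcomp using 1
  refine subset_antisymm (fun x hx => ?_) (iUnion₂_subset fun k _ => ?_)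
  · obtain ⟨ι, _, z, w, hz, hind, hw, hw1, rfl⟩ := eq_pos_convex_span_of_mem_convexHull hx
    have hcard := hind.card_le_finrank_succ
    have hle : finrank ℝ (vectorSpan ℝ (range z)) ≤ finrank ℝ E := Submodule.finrank_le _
    let e := Fintype.equivFin ι
    refine mem_iUnion₂.2 ⟨Fintype.card ι, Finset.mem_range.2 (by omega),
      (fun i => w (e.symm i), fun i => z (e.symm i)), ⟨⟨fun i => (hw _).le, ?_⟩, fun i _ => ?_⟩, ?_⟩
    · exact (e.symm.sum_comp w).trans hw1
    · exact hz (mem_range_self _)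
    · exact e.symm.sum_comp fun i => w i • z i
  · rintro _ ⟨⟨w, z⟩, ⟨hw, hz⟩, rfl⟩
    exact (convex_convexHull ℝ s).sum_mem (fun i _ => hw.1 i) hw.2 fun i _ =>
      subset_convexHull ℝ s (hz i trivial)

/-- If every direction into `K` from `x` is met with a nonnegative value by some generator, a
single element of the convex hull does so for all directions. -/
theorem exists_mem_convexHull_forall_inner_nonneg {K M : Set E} (hKc : IsCompact K)
    (hK : Convex ℝ K) (hKne : K.Nonempty) (hM : IsCompact M) (x : E)
    (h : ∀ y ∈ K, ∃ m ∈ M, 0 ≤ inner ℝ m (y - x)) :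
    ∃ v ∈ convexHull ℝ M, ∀ y ∈ K, 0 ≤ inner ℝ v (y - x) := by
  have hMne : M.Nonempty := let ⟨m, hm, _⟩ := h _ hKne.some_mem; ⟨m, hm⟩
  obtain ⟨y₀, hy₀, v₀, hv₀, hsad⟩ := Sion.exists_isSaddlePointOn (X := K) (Y := convexHull ℝ M)
    (f := fun y v => inner ℝ v (y - x)) hKne hK hKc
    (fun v _ => (by fun_prop : Continuous fun y => inner ℝ v (y - x)).continuousOn.lowerSemicontinuousOn)
    (fun v _ => ConvexOn.quasiconvexOn ⟨hK, fun a _ b _ s t _ _ hst => by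
      have h1 : s • a + t • b - x = s • (a - x) + t • (b - x) := by
        linear_combination (norm := module) hst • x
      simp only [h1, inner_add_right, inner_smul_right, smul_eq_mul, le_refl]⟩)
    (convex_convexHull ℝ M) hMne.convexHull hM.convexHull_of_finiteDimensional
    (fun y _ => (by fun_prop : Continuous fun v => inner ℝ v (y - x)).continuousOn.upperSemicontinuousOn)
    (fun y _ => ConcaveOn.quasiconcaveOn ⟨convex_convexHull ℝ M, fun a _ b _ s t _ _ hst => by
      simp [inner_add_left, inner_smul_left]⟩)
  refine ⟨v₀, hv₀, fun y hy => ?_⟩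
  -- The saddle value dominates the pairing of `y₀` with every generator, one of which is
  -- nonnegative.
  obtain ⟨m, hm, hm0⟩ := h y₀ hy₀
  exact hm0.trans (hsad y hy m (subset_convexHull ℝ M hm))

/-- A variational inequality over a compact convex set whose operator is the convex hull of a
map with compact graph is solvable. -/
theorem exists_solution_of_compact_graph {K : Set E} (hKc : IsCompact K) (hK : Convex ℝ K)
    (hKne : K.Nonempty) {M : E → Set E} (hgraph : IsCompact {q : E × E | q.1 ∈ K ∧ q.2 ∈ M q.1})
    (hMne : ∀ x ∈ K, (M x).Nonempty) :
    ∃ x ∈ K, ∃ v ∈ convexHull ℝ (M x), ∀ y ∈ K, 0 ≤ inner ℝ v (y - x) := by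
  by_contra! hcon
  have hMc : ∀ x ∈ K, IsCompact (M x) := fun x hx => by
    have : M x = Prod.snd '' ({q : E × E | q.1 ∈ K ∧ q.2 ∈ M q.1} ∩ {q | q.1 = x}) := by
      ext m
      constructor
      · exact fun hm => ⟨(x, m), ⟨⟨hx, hm⟩, rfl⟩, rfl⟩
      · rintro ⟨⟨x', m'⟩, ⟨⟨_, hm⟩, h⟩, rfl⟩
        exact h ▸ hm
    rw [this]
    exact (hgraph.inter_right (isClosed_eq continuous_fst continuous_const)).image continuous_snd
  -- By the minimax lemma, failure at `x` yields one direction that is bad for all generators at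
  -- once.
  have hdir : ∀ x ∈ K, ∃ y ∈ K, ∀ m ∈ M x, inner ℝ m (y - x) < 0 := by
    intro x hx
    by_contra! h
    obtain ⟨v, hv, hvy⟩ := exists_mem_convexHull_forall_inner_nonneg hKc hK hKne (hMc x hx) x h
    obtain ⟨y, hy, hlt⟩ := hcon x hx v hv
    exact hlt.not_ge (hvy y hy)
  have hsel : ∃ g : C(K, E), ∀ x : K, g x ∈ K ∩ {y | ∀ m ∈ M x, inner ℝ m (y - x) < 0} := by
    refine exists_continuous_forall_mem_convex_of_local_const (fun x => ?_) fun x => ?_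
    · refine hK.inter fun a ha b hb s t hs ht hst m hm => ?_
      have h1 : s • a + t • b - (x : E) = s • (a - x) + t • (b - x) := by
        linear_combination (norm := module) hst • (x : E)
      rw [h1, inner_add_right, inner_smul_right, inner_smul_right]
      have h2 := ha m hm
      have h3 := hb m hm
      rcases hs.eq_or_lt with rfl | hs'
      · rw [zero_add] at hst; subst hst; linarith
      · linarith [mul_neg_of_pos_of_neg hs' h2, mul_nonpos_of_nonneg_of_nonpos ht h3.le]
    · obtain ⟨y, hy, hlt⟩ := hdir x x.2
      refine ⟨y, ?_⟩
      -- The points at which `y` stops working form the projection of a compact set, so the same `y`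
      -- works near `x` and a partition of unity glues the choices.
      have hcl : IsClosed (Prod.fst '' ({q : E × E | q.1 ∈ K ∧ q.2 ∈ M q.1} ∩
          {q | 0 ≤ inner ℝ q.2 (y - q.1)})) :=
        ((hgraph.inter_right (isClosed_le continuous_const (by fun_prop))).image
          continuous_fst).isClosed
      have hmem : (x : E) ∉ Prod.fst '' ({q : E × E | q.1 ∈ K ∧ q.2 ∈ M q.1} ∩
          {q | 0 ≤ inner ℝ q.2 (y - q.1)}) := by
        rintro ⟨⟨x', m⟩, ⟨⟨_, hm⟩, h⟩, hx'⟩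
        simp only at hx'
        subst hx'
        exact (hlt m hm).not_ge h
      filter_upwards [continuous_subtype_val.continuousAt.preimage_mem_nhds
        (hcl.isOpen_compl.mem_nhds hmem)] with x' hx'
      refine ⟨hy, fun m hm => ?_⟩
      by_contra! h
      exact hx' ⟨(x', m), ⟨⟨x'.2, hm⟩, h⟩, rfl⟩
  obtain ⟨g, hg⟩ := hsel
  obtain ⟨x, hx⟩ := exists_fixedPoint_of_compact_convex hKne hKc hK g fun x => (hg x).1
  obtain ⟨m, hm⟩ := hMne x x.2
  have := (hg x).2 m hm
  simp [hx] at this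

end VariationalInequality

/-! ### Normal vectors and their stretching. -/

namespace PreferenceGNEP

open Set Metric Module Filter Topology

section NormalVectors

variable {F : Type*} [NormedAddCommGroup F] [InnerProductSpace ℝ F]

theorem normalCone_convexHull (C : Set F) (x : F) :
    normalCone (convexHull ℝ C) x = normalCone C x := by
  refine Subset.antisymm (fun v hv z hz => hv z (subset_convexHull ℝ C hz)) fun v hv => ?_
  have : convexHull ℝ C ⊆ {z | inner ℝ v z ≤ inner ℝ v x} := by
    refine convexHull_min (fun z hz => ?_) (convex_halfSpace_le (innerSL ℝ v).isLinear _)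
    have := hv z hz
    rw [inner_sub_right] at this
    exact sub_nonpos.1 this
  intro z hz
  rw [inner_sub_right]
  exact sub_nonpos.2 (this hz)

theorem convex_normalCone (C : Set F) (x : F) : Convex ℝ (normalCone C x) := by
  intro a ha b hb s t hs ht _ z hz
  rw [inner_add_left, real_inner_smul_left, real_inner_smul_left]
  exact add_nonpos (mul_nonpos_of_nonneg_of_nonpos hs (ha z hz))
    (mul_nonpos_of_nonneg_of_nonpos ht (hb z hz))

/-- The unit sphere of the subspace `V`, or `{0}` when `V` is trivial. -/
def sphereIn (V : Submodule ℝ F) : Set F :=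
  {u | u ∈ V ∧ (‖u‖ = 1 ∨ V = ⊥)}

theorem norm_le_one_of_mem_sphereIn {V : Submodule ℝ F} {u : F} (hu : u ∈ sphereIn V) :
    ‖u‖ ≤ 1 := by
  rcases hu.2 with h | h
  · exact h.le
  · have : u = 0 := by simpa [h] using hu.1
    simp [this]

theorem isCompact_sphereIn [FiniteDimensional ℝ F] (V : Submodule ℝ F) :
    IsCompact (sphereIn V) := by
  refine (isCompact_closedBall (0 : F) 1).of_isClosed_subset ?_ fun u hu =>
    mem_closedBall_zero_iff.2 (norm_le_one_of_mem_sphereIn hu)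
  exact V.closed_of_finiteDimensional.inter
    ((isClosed_eq continuous_norm continuous_const).union isClosed_const)

/-- Separate strictly and project the separating vector to `V`: its pairings with the `z - x` do not
change, and strictness makes the projection nonzero. -/
theorem exists_ne_zero_inner_nonpos_of_finite [FiniteDimensional ℝ F] {V : Submodule ℝ F}
    (hV : V ≠ ⊥) {C : Set F} (hC : C.Finite) {x : F} (hx : x ∉ convexHull ℝ C)
    (hCV : ∀ z ∈ C, z - x ∈ V) : ∃ v ∈ V, v ≠ 0 ∧ v ∈ normalCone C x := by
  rcases C.eq_empty_or_nonempty with rfl | ⟨z₀, hz₀⟩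
  · obtain ⟨v, hv, hv0⟩ := Submodule.exists_mem_ne_zero_of_ne_bot hV
    exact ⟨v, hv, hv0, fun z hz => hz.elim⟩
  obtain ⟨f, w, hfw, hwx⟩ := geometric_hahn_banach_closed_point (convex_convexHull ℝ C)
    (hC.isClosed_convexHull ℝ) hx
  let g := (InnerProductSpace.toDual ℝ F).symm f
  have hg : ∀ z ∈ C, inner ℝ (V.starProjection g) (z - x) < 0 := fun z hz => by
    have h1 : inner ℝ (V.starProjection g) (z - x) = inner ℝ g (z - x) := by
      rw [Submodule.inner_starProjection_left_eq_right,
        Submodule.starProjection_eq_self_iff.2 (hCV z hz)]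
    rw [h1, InnerProductSpace.toDual_symm_apply, map_sub]
    linarith [hfw z (subset_convexHull ℝ C hz)]
  refine ⟨_, V.starProjection_apply_mem g, fun h => ?_, fun z hz => (hg z hz).le⟩
  have := hg z₀ hz₀
  simp [h] at this

/-- The hull of `C` need not be closed, so finite subsets are separated and compactness of the
sphere gives a common normal. -/
theorem sphereIn_inter_normalCone_nonempty [FiniteDimensional ℝ F] {V : Submodule ℝ F}
    {C : Set F} {x : F} (hx : x ∉ convexHull ℝ C) (hCV : ∀ z ∈ C, z - x ∈ V) :
    (sphereIn V ∩ normalCone C x).Nonempty := by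
  by_cases hV : V = ⊥
  · exact ⟨0, ⟨V.zero_mem, Or.inr hV⟩, fun z _ => by simp⟩
  have h := (isCompact_sphereIn V).inter_iInter_nonempty
    (fun z : C => {u : F | inner ℝ u ((z : F) - x) ≤ 0})
    (fun z => isClosed_le (by fun_prop) continuous_const) fun s => ?_
  · obtain ⟨u, hu, hu'⟩ := h
    exact ⟨u, hu, fun z hz => mem_iInter.1 hu' ⟨z, hz⟩⟩
  · have hs : (((↑) : C → F) '' s) ⊆ C := by rintro _ ⟨z, _, rfl⟩; exact z.2
    obtain ⟨v, hv, hv0, hvn⟩ := exists_ne_zero_inner_nonpos_of_finite hV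
      (s.finite_toSet.image ((↑) : C → F)) (fun h => hx (convexHull_mono hs h))
      fun z hz => hCV z (hs hz)
    refine ⟨‖v‖⁻¹ • v, ⟨V.smul_mem _ hv, Or.inl (norm_smul_inv_norm (𝕜 := ℝ) hv0)⟩, ?_⟩
    refine mem_iInter₂.2 fun z hz => ?_
    rw [mem_ofPred_eq, real_inner_smul_left]
    exact mul_nonpos_of_nonneg_of_nonpos (by positivity) (hvn z ⟨z, hz, rfl⟩)

/-- The factor by which a normal vector `u` at `x` is stretched according to how far `u` points
away from `a`. -/
def stretch (L : ℝ) (a x u : F) : ℝ :=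
  1 + L * max 0 (-inner ℝ u (a - x))

theorem stretch_pos {L : ℝ} (hL : 0 ≤ L) (a x u : F) : 0 < stretch L a x u := by
  have : 0 ≤ max 0 (-inner ℝ u (a - x)) := le_max_left _ _
  unfold stretch; positivity

/-- Stretching amplifies negative pairings only, so upper bounds on `⟪v, a - x⟫` do not depend on
`L`. -/
theorem stretch_mul_inner_le {L : ℝ} (hL : 0 ≤ L) (a x u : F) :
    stretch L a x u * inner ℝ u (a - x) ≤ max 0 (inner ℝ u (a - x)) := by
  rcases le_or_gt 0 (inner ℝ u (a - x)) with h | h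
  · rw [stretch, max_eq_left (neg_nonpos.2 h), max_eq_right h]; simp
  · exact (mul_neg_of_pos_of_neg (stretch_pos hL a x u) h).le.trans (le_max_left _ _)

/-- Stretched unit normal vectors in the subspace `V` to the set `C` at `x`. -/
def stretchedNormals (V : Submodule ℝ F) (L : ℝ) (a : F) (C : Set F) (x : F) : Set F :=
  (fun u => stretch L a x u • u) '' (sphereIn V ∩ normalCone C x)

theorem convexHull_stretchedNormals_subset_normalCone {V : Submodule ℝ F} {L : ℝ} (hL : 0 ≤ L)
    (a : F) (C : Set F) (x : F) :
    convexHull ℝ (stretchedNormals V L a C x) ⊆ normalCone C x := by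
  refine convexHull_min ?_ (convex_normalCone C x)
  rintro _ ⟨u, ⟨_, hu⟩, rfl⟩ z hz
  rw [real_inner_smul_left]
  exact mul_nonpos_of_nonneg_of_nonpos (stretch_pos hL a x u).le (hu z hz)

theorem inner_le_of_mem_convexHull_stretchedNormals {V : Submodule ℝ F} {L : ℝ} (hL : 0 ≤ L)
    {a : F} {C : Set F} {x : F} {v : F} (hv : v ∈ convexHull ℝ (stretchedNormals V L a C x)) :
    inner ℝ v (a - x) ≤ ‖a - x‖ := by
  have : convexHull ℝ (stretchedNormals V L a C x) ⊆ {v | inner ℝ v (a - x) ≤ ‖a - x‖} := by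
    refine convexHull_min ?_ ?_
    · rintro _ ⟨u, ⟨hu, _⟩, rfl⟩
      rw [mem_ofPred_eq, real_inner_smul_left]
      refine (stretch_mul_inner_le hL a x u).trans (max_le (norm_nonneg _) ?_)
      refine (real_inner_le_norm _ _).trans ?_
      exact mul_le_of_le_one_left (norm_nonneg _) (norm_le_one_of_mem_sphereIn hu)
    · intro p hp q hq s t hs ht hst
      rw [mem_ofPred_eq] at *
      rw [inner_add_left, real_inner_smul_left, real_inner_smul_left]
      calc _ ≤ s * ‖a - x‖ + t * ‖a - x‖ := by gcongr
        _ = _ := by rw [← add_mul, hst, one_mul]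
  exact this hv

/-- A lexicographic condition: a combination vanishing on `p` uses only vectors vanishing on `p`. It
carries a dichotomy from generators to their hull. -/
theorem convex_neg_or_eq_zero_and_le (p q : F) (c : ℝ) :
    Convex ℝ {v : F | inner ℝ v p < 0 ∨ inner ℝ v p = 0 ∧ inner ℝ v q ≤ c} := by
  intro v hv w hw s t hs ht hst
  rw [mem_ofPred_eq] at *
  simp only [inner_add_left, real_inner_smul_left]
  rcases hs.eq_or_lt with rfl | hs
  · obtain rfl : t = 1 := by linarith
    simpa using hw
  rcases ht.eq_or_lt with rfl | ht
  · obtain rfl : s = 1 := by linarith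
    simpa using hv
  rcases hv with hv | ⟨hv, hv'⟩
  · left
    have := mul_neg_of_pos_of_neg hs hv
    rcases hw with hw | ⟨hw, -⟩
    · linarith [mul_neg_of_pos_of_neg ht hw]
    · rw [hw]; linarith
  · rcases hw with hw | ⟨hw, hw'⟩
    · left; rw [hv]; linarith [mul_neg_of_pos_of_neg ht hw]
    · right
      refine ⟨by rw [hv, hw]; ring, ?_⟩
      calc _ ≤ s * c + t * c := by gcongr
        _ = c := by rw [← add_mul, hst, one_mul]

/-- A normal vector at `x` to a relatively open subset `U ∩ A` of `A` that is orthogonal to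
`z - x` for some `z ∈ U ∩ A` is normal to `A` at `x`. -/
theorem mem_normalCone_of_inner_eq_zero {A U : Set F} (hA : Convex ℝ A) (hU : IsOpen U) {x z u : F}
    (hz : z ∈ U ∩ A) (hu : u ∈ normalCone (U ∩ A) x) (h0 : inner ℝ u (z - x) = 0) :
    u ∈ normalCone A x := by
  intro y hy
  have hcont : Continuous fun t : ℝ => z + t • (y - z) := by fun_prop
  have hev : ∀ᶠ t in 𝓝[>] (0 : ℝ), z + t • (y - z) ∈ U ∧ t < 1 :=
    nhdsWithin_le_nhds ((hcont.continuousAt.eventually_mem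
      (hU.mem_nhds (by simpa using hz.1))).and (gt_mem_nhds one_pos))
  obtain ⟨t, ⟨htU, ht1⟩, ht0⟩ := (hev.and self_mem_nhdsWithin).exists
  have hmem := hu _ ⟨htU, hA.add_smul_sub_mem hz.2 hy ⟨ht0.le, ht1.le⟩⟩
  have h1 : z + t • (y - z) - x = (z - x) + t • ((y - x) - (z - x)) := by module
  rw [h1, inner_add_right, inner_smul_right, inner_sub_right u (y - x), h0] at hmem
  nlinarith

/-- A generator `u` orthogonal to `z - x` is normal to all of `A`; testing at `a + r • u` gives `⟪u,
a - x⟫ ≤ -r`, which the stretch turns into at most `-(L * r ^ 2)`. -/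
theorem inner_neg_or_of_mem_convexHull_stretchedNormals {A U : Set F} (hA : Convex ℝ A)
    (hU : IsOpen U) {V : Submodule ℝ F} {L r : ℝ} (hL : 0 ≤ L) (hr : 0 < r) {a x z v : F}
    (hz : z ∈ U ∩ A) (hzV : z - x ∈ V) (hzx : z ≠ x)
    (ha : ∀ u ∈ V, ‖u‖ ≤ 1 → a + r • u ∈ A)
    (hv : v ∈ convexHull ℝ (stretchedNormals V L a (U ∩ A) x)) :
    inner ℝ v (z - x) < 0 ∨ inner ℝ v (z - x) = 0 ∧ inner ℝ v (a - x) ≤ -(L * r ^ 2) := by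
  refine convexHull_min ?_ (convex_neg_or_eq_zero_and_le (z - x) (a - x) _) hv
  rintro _ ⟨u, ⟨huV, hu⟩, rfl⟩
  have hpos := stretch_pos hL a x u
  simp only [mem_ofPred_eq, real_inner_smul_left]
  rcases (hu z hz).lt_or_eq with h | h
  · exact Or.inl (mul_neg_of_pos_of_neg hpos h)
  · refine Or.inr ⟨by rw [h, mul_zero], ?_⟩
    have hu1 : ‖u‖ = 1 := huV.2.resolve_right fun hV => by
      rw [hV, Submodule.mem_bot] at hzV
      exact hzx (sub_eq_zero.1 hzV)
    have h1 := mem_normalCone_of_inner_eq_zero hA hU hz hu h _ (ha u huV.1 hu1.le)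
    rw [add_sub_right_comm, inner_add_right, inner_smul_right, real_inner_self_eq_norm_sq, hu1] at h1
    set c := inner ℝ u (a - x)
    have hc : c ≤ -r := by linarith
    rw [stretch, max_eq_right (by linarith : 0 ≤ -inner ℝ u (a - x))]
    have hr2 : r ^ 2 ≤ c ^ 2 := by nlinarith
    change (1 + L * -c) * c ≤ _
    nlinarith [mul_le_mul_of_nonneg_left hr2 hL]

theorem exists_relative_ball_subset [FiniteDimensional ℝ F] {A : Set F} (hA : Convex ℝ A)
    (hne : A.Nonempty) :
    ∃ a ∈ A, ∃ r > (0 : ℝ), ∀ u ∈ vectorSpan ℝ A, ‖u‖ ≤ 1 → a + r • u ∈ A := by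
  obtain ⟨a, ⟨a', ha', rfl⟩⟩ := hne.intrinsicInterior hA
  have hsub : interior ((↑) ⁻¹' A : Set (affineSpan ℝ A)) ⊆ (↑) ⁻¹' A := interior_subset
  obtain ⟨ε, hε, hball⟩ := Metric.isOpen_iff.1 isOpen_interior a' ha'
  refine ⟨a', hsub ha', ε / 2, by positivity, fun u hu hu1 => ?_⟩
  have hmem : (a' : F) + (ε / 2) • u ∈ affineSpan ℝ A := by
    rw [add_comm]
    refine AffineSubspace.vadd_mem_of_mem_direction ?_ a'.2
    rw [direction_affineSpan]
    exact Submodule.smul_mem _ _ hu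
  have : (⟨_, hmem⟩ : affineSpan ℝ A) ∈ ball a' ε := by
    rw [mem_ball, Subtype.dist_eq, dist_eq_norm, add_sub_cancel_left, norm_smul,
      Real.norm_of_nonneg (by positivity)]
    nlinarith
  exact hsub (hball this)

end NormalVectors

end PreferenceGNEP

/-! ### The game: existence of solutions and equilibria. -/

namespace PreferenceGNEP

open Set Metric Module Filter Topology

section Game

variable {N : ℕ} {n : Fin N → ℕ}

theorem mem_productSet_choiceSet {S : Set (Profile n)} {x : Profile n} (hx : x ∈ S) :
    x ∈ productSet (choiceSet S) := fun _ => ⟨x, hx, rfl⟩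

theorem convex_choiceSet {S : Set (Profile n)} (hS : Convex ℝ S) (i : Fin N) :
    Convex ℝ (choiceSet S i) := by
  rintro _ ⟨x, hx, rfl⟩ _ ⟨y, hy, rfl⟩ s t hs ht hst
  exact ⟨s • x + t • y, hS hx hy hs ht hst, rfl⟩

@[simp]
theorem deviate_same (x : Profile n) (i : Fin N) (z : EuclideanSpace ℝ (Fin (n i))) :
    deviate x i z i = z := by
  simp [deviate]

theorem deviate_of_ne (x : Profile n) {i j : Fin N} (z : EuclideanSpace ℝ (Fin (n i)))
    (h : j ≠ i) : deviate x i z j = x j := by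
  simp [deviate, h]

theorem deviate_self (x : Profile n) (i : Fin N) : deviate x i (x i) = x := by
  simp [deviate]

theorem inner_deviate_sub (v x : Profile n) (i : Fin N) (z : EuclideanSpace ℝ (Fin (n i))) :
    inner ℝ v (deviate x i z - x) = inner ℝ (v i) (z - x i) := by
  rw [PiLp.inner_apply, Finset.sum_eq_single i]
  · simp
  · intro j _ hj
    simp [deviate_of_ne x z hj]
  · simp

theorem isEquilibrium_of_forall_inter_eq_empty {S : Set (Profile n)}
    {P : ∀ i, Profile n → Set (EuclideanSpace ℝ (Fin (n i)))} {x : Profile n} (hx : x ∈ S)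
    (h : ∀ i, P i x ∩ constraintMap S i x = ∅) :
    IsEquilibrium (choiceSet S) (constraintMap S) P x :=
  ⟨mem_productSet_choiceSet hx, fun i => ⟨⟨⟨x, hx, rfl⟩, by rwa [deviate_self]⟩, h i⟩⟩

/-- A coercivity argument: a solution of the variational inequality on a ball solves it on the
whole constraint set. -/
theorem forall_inner_nonneg_of_coercive {E : Type*} [NormedAddCommGroup E] [InnerProductSpace ℝ E]
    {S : Set E} (hS : Convex ℝ S) {R : ℝ} {x v z : E}
    (h : ∀ y ∈ S ∩ closedBall 0 R, 0 ≤ inner ℝ v (y - x)) (hz : z ∈ S) (hzR : ‖z‖ < R)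
    (hvz : inner ℝ v (z - x) ≤ 0) : ∀ y ∈ S, 0 ≤ inner ℝ v (y - x) := by
  intro y hy
  have hcont : Continuous fun t : ℝ => z + t • (y - z) := by fun_prop
  have hev : ∀ᶠ t in 𝓝[>] (0 : ℝ), z + t • (y - z) ∈ ball (0 : E) R ∧ t < 1 :=
    nhdsWithin_le_nhds ((hcont.continuousAt.eventually_mem
      (isOpen_ball.mem_nhds (by simpa using hzR))).and (gt_mem_nhds one_pos))
  obtain ⟨t, ⟨htR, ht1⟩, ht0⟩ := (hev.and self_mem_nhdsWithin).exists
  have ht0' : (0 : ℝ) < t := ht0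
  -- The pairing with `z - x` is therefore 0, so `z` is also a minimizer, and it is interior to the
  -- ball.
  have h0 := h z ⟨hz, mem_closedBall_zero_iff.2 hzR.le⟩
  have h1 := h _ ⟨hS.add_smul_sub_mem hz hy ⟨ht0'.le, ht1.le⟩, ball_subset_closedBall htR⟩
  have h2 : z + t • (y - z) - x = (z - x) + t • ((y - x) - (z - x)) := by module
  rw [h2, inner_add_right, inner_smul_right, inner_sub_right v (y - x)] at h1
  nlinarith

variable {S : Set (Profile n)} {P : ∀ i, Profile n → Set (EuclideanSpace ℝ (Fin (n i)))}

/-- A violated inequality at some `z ∈ P i x` persists nearby, because lower semicontinuity supplies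
points of `P i x'` close to `z`. -/
theorem isClosed_graph_normalCone
    (hPlsc : ∀ i, LowerHemicontinuousOn (P i) (productSet (choiceSet S)))
    {G : Set (Profile n × ∀ i, EuclideanSpace ℝ (Fin (n i)))} (hG : IsClosed G)
    (hGS : ∀ q ∈ G, q.1 ∈ S) :
    IsClosed (G ∩ {q | ∀ i, q.2 i ∈ normalCone (P i q.1) (q.1 i)}) := by
  refine isClosed_of_closure_subset fun q hq => ?_
  have hqG : q ∈ G := closure_minimal inter_subset_left hG hq
  refine ⟨hqG, fun i z hz => ?_⟩
  by_contra! hpos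
  have hcont : Continuous fun p : (Profile n × ∀ i, EuclideanSpace ℝ (Fin (n i))) ×
      EuclideanSpace ℝ (Fin (n i)) => inner ℝ (p.1.2 i) (p.2 - p.1.1 i) := by fun_prop
  have hev := (hcont.continuousAt (x := (q, z))).eventually (lt_mem_nhds hpos)
  rw [nhds_prod_eq] at hev
  obtain ⟨p₁, hp₁, p₂, hp₂, hp⟩ := eventually_prod_iff.1 hev
  obtain ⟨W, hWp, hW, hzW⟩ := _root_.eventually_nhds_iff.1 hp₂
  have hlsc := lowerHemicontinuousWithinAt_iff.1
    (hPlsc i q.1 (mem_productSet_choiceSet (hGS q hqG))) W hW ⟨z, hz, hzW⟩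
  rw [eventually_nhdsWithin_iff] at hlsc
  have hlsc' := (continuous_fst.continuousAt (x := q)).eventually hlsc
  obtain ⟨q', ⟨hq'1, hq'2⟩, hq'3, hq'4⟩ :=
    ((mem_closure_iff_frequently.1 hq).and_eventually (hp₁.and hlsc')).exists
  obtain ⟨z', hz', hz'W⟩ := hq'4 (mem_productSet_choiceSet (hGS q' hq'1))
  exact (hp hq'3 (hWp z' hz'W)).not_ge (hq'2 i z' hz')

/-- The common source of both existence claims: `V = ⊤`, `L = 0` gives `T`, while direction spaces
and large `L` give equilibria. -/
theorem exists_solution_stretchedNormals (hclosed : IsClosed S) (hconv : Convex ℝ S)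
    (hPlsc : ∀ i, LowerHemicontinuousOn (P i) (productSet (choiceSet S)))
    (hPirr : ∀ i, ∀ x ∈ productSet (choiceSet S), x i ∉ convexHull ℝ (P i x))
    {ρ ρ' : ℝ} (hcoer : ∀ x ∈ S \ closedBall 0 ρ, ∃ z ∈ S, ‖z‖ < ‖x‖ ∧ ∀ i, z i ∈ P i x)
    (hρ' : ρ < ρ') (hball : (S ∩ closedBall 0 ρ').Nonempty)
    {V : ∀ i, Submodule ℝ (EuclideanSpace ℝ (Fin (n i)))}
    (hV : ∀ i, ∀ x ∈ S, ∀ z ∈ P i x, z - x i ∈ V i)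
    {L : Fin N → ℝ} (hL : ∀ i, 0 ≤ L i) (a : Profile n) :
    ∃ x ∈ S ∩ closedBall 0 ρ', ∃ v : Profile n,
      (∀ i, v i ∈ convexHull ℝ (stretchedNormals (V i) (L i) (a i) (P i x) (x i))) ∧
      ∀ y ∈ S, 0 ≤ inner ℝ v (y - x) := by
  let K := S ∩ closedBall (0 : Profile n) ρ'
  have hK : IsCompact K := (isCompact_closedBall _ _).inter_left hclosed
  have hKconv : Convex ℝ K := hconv.inter (convex_closedBall _ _)
  let M : Profile n → Set (Profile n) := fun x =>
    {v | ∀ i, v i ∈ stretchedNormals (V i) (L i) (a i) (P i x) (x i)}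
  let Φ : (Profile n × ∀ i, EuclideanSpace ℝ (Fin (n i))) → Profile n × Profile n := fun q =>
    (q.1, WithLp.toLp 2 fun i => stretch (L i) (a i) (q.1 i) (q.2 i) • q.2 i)
  have hΦ : Continuous Φ := by
    unfold Φ stretch
    fun_prop
  let G : Set (Profile n × ∀ i, EuclideanSpace ℝ (Fin (n i))) :=
    K ×ˢ univ.pi fun i => sphereIn (V i)
  have hGc : IsCompact G := hK.prod (isCompact_univ_pi fun i => isCompact_sphereIn (V i))
  have hgraph : IsCompact {q : Profile n × Profile n | q.1 ∈ K ∧ q.2 ∈ M q.1} := by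
    have : {q : Profile n × Profile n | q.1 ∈ K ∧ q.2 ∈ M q.1} =
        Φ '' (G ∩ {q | ∀ i, q.2 i ∈ normalCone (P i q.1) (q.1 i)}) := by
      ext ⟨x, v⟩
      constructor
      · rintro ⟨hx, hv⟩
        choose u hu huv using hv
        refine ⟨(x, u), ⟨⟨hx, fun i _ => (hu i).1⟩, fun i => (hu i).2⟩, ?_⟩
        refine Prod.ext rfl (PiLp.ext fun i => huv i)
      · rintro ⟨⟨x', u⟩, ⟨⟨hx, hu⟩, hu'⟩, h⟩
        obtain ⟨rfl, rfl⟩ := Prod.ext_iff.1 h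
        exact ⟨hx, fun i => ⟨u i, ⟨hu i trivial, hu' i⟩, rfl⟩⟩
    rw [this]
    exact (hGc.of_isClosed_subset (isClosed_graph_normalCone hPlsc hGc.isClosed
      fun q hq => hq.1.1) inter_subset_left).image hΦ
  have hMne : ∀ x ∈ K, (M x).Nonempty := fun x hx => by
    choose u hu using fun i => sphereIn_inter_normalCone_nonempty
      (hPirr i x (mem_productSet_choiceSet hx.1)) (hV i x hx.1)
    exact ⟨WithLp.toLp 2 fun i => stretch (L i) (a i) (x i) (u i) • u i,
      fun i => ⟨u i, hu i, rfl⟩⟩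
  obtain ⟨x, hx, v, hv, hvi⟩ := exists_solution_of_compact_graph hK hKconv hball hgraph hMne
  have hv' : ∀ i, v i ∈ convexHull ℝ (stretchedNormals (V i) (L i) (a i) (P i x) (x i)) := by
    refine convexHull_min (t := {v : Profile n | ∀ i, v i ∈
      convexHull ℝ (stretchedNormals (V i) (L i) (a i) (P i x) (x i))}) ?_ ?_ hv
    · exact fun w hw i => subset_convexHull ℝ _ (hw i)
    · exact fun p hp q hq s t hs ht hst i => convex_convexHull ℝ _ (hp i) (hq i) hs ht hst
  refine ⟨x, hx, v, hv', ?_⟩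
  rcases (mem_closedBall_zero_iff.1 hx.2).lt_or_eq with h | h
  · exact forall_inner_nonneg_of_coercive hconv hvi hx.1 h (by simp)
  -- On the boundary sphere `‖x‖ = ρ' > ρ`, so coercivity applies; each `v i` is normal to `P i x`,
  -- hence `⟪v, z - x⟫ ≤ 0`.
  · obtain ⟨z, hz, hzx, hzP⟩ := hcoer x ⟨hx.1, fun hρ =>
      (mem_closedBall_zero_iff.1 hρ).not_gt (h ▸ hρ')⟩
    refine forall_inner_nonneg_of_coercive hconv hvi hz (h ▸ hzx) ?_
    rw [PiLp.inner_apply]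
    exact Finset.sum_nonpos fun i _ =>
      convexHull_stretchedNormals_subset_normalCone (hL i) _ _ _ (hv' i) (z i) (hzP i)

theorem exists_solvesVI_gameOperator (hn : ∀ i, 0 < n i) (hclosed : IsClosed S)
    (hconv : Convex ℝ S) (hPlsc : ∀ i, LowerHemicontinuousOn (P i) (productSet (choiceSet S)))
    (hPirr : ∀ i, ∀ x ∈ productSet (choiceSet S), x i ∉ convexHull ℝ (P i x))
    {ρ ρ' : ℝ} (hcoer : ∀ x ∈ S \ closedBall 0 ρ, ∃ z ∈ S, ‖z‖ < ‖x‖ ∧ ∀ i, z i ∈ P i x)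
    (hρ' : ρ < ρ') (hball : (S ∩ closedBall 0 ρ').Nonempty) :
    ∃ x, SolvesVI (gameOperator P) S x := by
  obtain ⟨x, hx, v, hv, hvi⟩ := exists_solution_stretchedNormals hclosed hconv hPlsc hPirr hcoer
    hρ' hball (V := fun _ => ⊤) (fun _ _ _ _ _ => trivial) (L := fun _ => 0) (fun _ => le_rfl) 0
  refine ⟨x, hx.1, v, fun i => convexHull_mono ?_ (hv i), hvi⟩
  rintro _ ⟨u, ⟨hu, huN⟩, rfl⟩
  -- Positive dimension excludes the degenerate value `{0}` of `sphereIn`.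
  have : NeZero (n i) := ⟨(hn i).ne'⟩
  simp only [stretch, zero_mul, add_zero, one_smul, normalCone_convexHull]
  exact ⟨huN, mem_sphere_zero_iff_norm.2 (hu.2.resolve_right top_ne_bot)⟩

/-- Every convex set of profiles contains a profile all of whose components are relatively
interior in the choice sets. -/
theorem exists_forall_relative_ball_subset_choiceSet (hne : S.Nonempty) (hconv : Convex ℝ S) :
    ∃ a ∈ S, ∃ r : Fin N → ℝ, (∀ i, 0 < r i) ∧
      ∀ i, ∀ u ∈ vectorSpan ℝ (choiceSet S i), ‖u‖ ≤ 1 → a i + r i • u ∈ choiceSet S i := by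
  rcases Nat.eq_zero_or_pos N with rfl | hN
  · exact ⟨_, hne.some_mem, fun i => i.elim0, fun i => i.elim0, fun i => i.elim0⟩
  choose b hb r hr hbr using fun i =>
    exists_relative_ball_subset (convex_choiceSet hconv i) (hne.image fun x : Profile n => x i)
  choose s hs hsb using hb
  have hN' : (0 : ℝ) < N := by exact_mod_cast hN
  have hsum : ∑ _j : Fin N, (N : ℝ)⁻¹ = 1 := by simp [hN'.ne']
  -- Average profiles `s j` whose `j`-th component is relatively interior; moving only `s i` leaves
  -- room `r i / N` in component `i`.
  refine ⟨∑ j, (N : ℝ)⁻¹ • s j, hconv.sum_mem (fun _ _ => by positivity) hsum fun j _ => hs j,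
    fun i => (N : ℝ)⁻¹ * r i, fun i => mul_pos (by positivity) (hr i), fun i u hu hu1 => ?_⟩
  have h1 : (∑ j, (N : ℝ)⁻¹ • s j) i + ((N : ℝ)⁻¹ * r i) • u =
      ∑ j, (N : ℝ)⁻¹ • (s j i + if j = i then r i • u else 0) := by
    simp only [smul_add, Finset.sum_add_distrib, smul_ite, smul_zero, Finset.sum_ite_eq',
      Finset.mem_univ, if_true, smul_smul]
    simp
  rw [h1]
  refine (convex_choiceSet hconv i).sum_mem (fun _ _ => by positivity) hsum fun j _ => ?_
  split_ifs with hj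
  · subst hj
    rw [show s j j = b j from hsb j]
    exact hbr j u hu hu1
  · rw [add_zero]; exact ⟨s j, hs j, rfl⟩

theorem exists_isEquilibrium (hne : S.Nonempty) (hclosed : IsClosed S) (hconv : Convex ℝ S)
    (hPsub : ∀ i, ∀ x ∈ productSet (choiceSet S), P i x ⊆ choiceSet S i)
    (hPlsc : ∀ i, LowerHemicontinuousOn (P i) (productSet (choiceSet S)))
    (hPopen : ∀ i, HasOpenUpperSections (P i) (productSet (choiceSet S)) (choiceSet S i))
    (hPirr : ∀ i, ∀ x ∈ productSet (choiceSet S), x i ∉ convexHull ℝ (P i x))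
    {ρ ρ' : ℝ} (hcoer : ∀ x ∈ S \ closedBall 0 ρ, ∃ z ∈ S, ‖z‖ < ‖x‖ ∧ ∀ i, z i ∈ P i x)
    (hρ' : ρ < ρ') (hball : (S ∩ closedBall 0 ρ').Nonempty) :
    ∃ x, IsEquilibrium (choiceSet S) (constraintMap S) P x := by
  obtain ⟨a, haS, r, hr, har⟩ := exists_forall_relative_ball_subset_choiceSet hne hconv
  set D := ‖a‖ + ρ'
  have hD : 0 ≤ D := by
    obtain ⟨x, hx⟩ := hball
    have := (norm_nonneg x).trans (mem_closedBall_zero_iff.1 hx.2)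
    positivity
  -- Then `L * r ^ 2 = N * D + 1` exceeds what all other players can contribute, each at most `D ≥
  -- ‖a - x‖`.
  have hL : ∀ i, 0 ≤ (N * D + 1) / r i ^ 2 := fun i => by positivity
  have hdir : ∀ i, ∀ x ∈ S, ∀ z ∈ P i x, z - x i ∈ vectorSpan ℝ (choiceSet S i) :=
    fun i x hx z hz => vsub_mem_vectorSpan ℝ (hPsub i x (mem_productSet_choiceSet hx) hz)
      ⟨x, hx, rfl⟩
  obtain ⟨x, hx, v, hv, hvi⟩ := exists_solution_stretchedNormals hclosed hconv hPlsc hPirr hcoer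
    hρ' hball hdir hL a
  have hxX := mem_productSet_choiceSet hx.1
  refine ⟨x, isEquilibrium_of_forall_inter_eq_empty hx.1 fun i => ?_⟩
  refine eq_empty_of_forall_notMem fun z ⟨hzP, hzK, hzS⟩ => ?_
  have hge := hvi _ hzS
  rw [inner_deviate_sub] at hge
  have hzx : z ≠ x i := fun h => hPirr i x hxX (subset_convexHull ℝ _ (h ▸ hzP))
  have hzV := hdir i x hx.1 z hzP
  obtain ⟨U, hU, hPU⟩ := hPopen i x hxX
  have hvi' := hv i
  rw [hPU] at hvi' hzP
  have hlt := ((inner_neg_or_of_mem_convexHull_stretchedNormals (convex_choiceSet hconv i) hU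
    (hL i) (hr i) hzP hzV hzx (har i) hvi').resolve_left hge.not_gt).2
  rw [div_mul_cancel₀ _ (pow_pos (hr i) 2).ne'] at hlt
  have hle : ∀ j ∈ Finset.univ.erase i, inner ℝ (v j) (a j - x j) ≤ D := fun j _ => by
    refine (inner_le_of_mem_convexHull_stretchedNormals (hL j) (hv j)).trans ?_
    refine (PiLp.norm_apply_le (a - x) j).trans ((norm_sub_le _ _).trans ?_)
    exact add_le_add_right (mem_closedBall_zero_iff.1 hx.2) _
  have hsum := Finset.sum_le_card_nsmul _ _ _ hle
  have hcard : ((Finset.univ.erase i).card : ℝ) ≤ N := by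
    exact_mod_cast (Finset.card_le_univ _).trans_eq (Fintype.card_fin N)
  -- Testing at `a` gives a nonnegative sum, yet player `i` contributes at most `-(N * D + 1)` and
  -- the others at most `N * D`.
  have htot := hvi a haS
  rw [PiLp.inner_apply, ← Finset.add_sum_erase _ _ (Finset.mem_univ i)] at htot
  rw [nsmul_eq_mul] at hsum
  simp only [PiLp.sub_apply] at htot
  linarith [mul_le_mul_of_nonneg_right hcard hD]

/-- Equality would make `u` normal to the whole space, hence zero. -/
theorem inner_neg_of_isOpen {F : Type*} [NormedAddCommGroup F] [InnerProductSpace ℝ F]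
    {C : Set F} (hC : IsOpen C) {x z u : F} (hz : z ∈ C) (hu : u ∈ normalCone C x) (hu0 : u ≠ 0) :
    inner ℝ u (z - x) < 0 := by
  refine (hu z hz).lt_of_ne fun h0 => hu0 ?_
  have h1 := mem_normalCone_of_inner_eq_zero convex_univ hC (by simpa using hz)
    (by simpa using hu) h0 (x + u) trivial
  rw [add_sub_cancel_left] at h1
  exact real_inner_self_nonpos.1 h1

theorem isEquilibrium_of_solvesVI
    (hPopen : ∀ i, ∀ x ∈ productSet (choiceSet S), IsOpen (P i x)) {x : Profile n}
    (hx : SolvesVI (gameOperator P) S x) :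
    IsEquilibrium (choiceSet S) (constraintMap S) P x := by
  obtain ⟨hxS, v, hv, hvi⟩ := hx
  refine isEquilibrium_of_forall_inter_eq_empty hxS fun i => ?_
  refine eq_empty_of_forall_notMem fun z ⟨hzP, _, hzS⟩ => ?_
  have hge := hvi _ hzS
  rw [inner_deviate_sub] at hge
  have hsub : playerOperator P i x ⊆ {w | inner ℝ w (z - x i) < 0} := by
    refine convexHull_min ?_ ?_
    · rintro u ⟨hu, hu1⟩
      rw [normalCone_convexHull] at hu
      exact inner_neg_of_isOpen (hPopen i x (mem_productSet_choiceSet hxS)) hzP hu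
        (ne_of_mem_sphere hu1 one_ne_zero)
    · have h1 : {w | inner ℝ w (z - x i) < 0} = {w | innerSL ℝ (z - x i) w < 0} := by
        ext w
        rw [mem_ofPred_eq, real_inner_comm]
        rfl
      rw [h1]
      exact convex_halfSpace_lt (innerSL ℝ (z - x i)).isLinear 0
  exact (hsub (hv i)).not_ge hge

end Game

end PreferenceGNEP

theorem mainTheorem2 {N : ℕ} (n : Fin N → ℕ) (hn : ∀ i, 0 < n i)
    (S : Set (PreferenceGNEP.Profile n))
    (hne : S.Nonempty) (hclosed : IsClosed S) (hconv : Convex ℝ S)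
    (P : ∀ i, PreferenceGNEP.Profile n → Set (EuclideanSpace ℝ (Fin (n i))))
    (hPsub : ∀ i, ∀ x ∈ PreferenceGNEP.productSet (PreferenceGNEP.choiceSet S),
      P i x ⊆ PreferenceGNEP.choiceSet S i)
    (hPlsc : ∀ i, LowerHemicontinuousOn (P i)
      (PreferenceGNEP.productSet (PreferenceGNEP.choiceSet S)))
    (hPopen : ∀ i, PreferenceGNEP.HasOpenUpperSections (P i)
      (PreferenceGNEP.productSet (PreferenceGNEP.choiceSet S)) (PreferenceGNEP.choiceSet S i))
    (hPirr : ∀ i, ∀ x ∈ PreferenceGNEP.productSet (PreferenceGNEP.choiceSet S),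
      x i ∉ convexHull ℝ (P i x))
    (ρ : ℝ) (hρ : 0 < ρ)
    (hcoer : ∀ x ∈ S \ Metric.closedBall 0 ρ, ∃ z ∈ S, ‖z‖ < ‖x‖ ∧ ∀ i, z i ∈ P i x)
    (ρ' : ℝ) (hρ' : ρ < ρ') (hball : (S ∩ Metric.closedBall 0 ρ').Nonempty) :
    (∃ x, PreferenceGNEP.IsEquilibrium (PreferenceGNEP.choiceSet S)
      (PreferenceGNEP.constraintMap S) P x) ∧
    (∃ x, PreferenceGNEP.SolvesVI (PreferenceGNEP.gameOperator P) S x) ∧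
    ((∀ i, ∀ x ∈ PreferenceGNEP.productSet (PreferenceGNEP.choiceSet S), IsOpen (P i x)) →
      ∀ x, PreferenceGNEP.SolvesVI (PreferenceGNEP.gameOperator P) S x →
        PreferenceGNEP.IsEquilibrium (PreferenceGNEP.choiceSet S)
          (PreferenceGNEP.constraintMap S) P x) := by
  exact ⟨PreferenceGNEP.exists_isEquilibrium hne hclosed hconv hPsub hPlsc hPopen hPirr hcoer hρ'
      hball,
    PreferenceGNEP.exists_solvesVI_gameOperator hn hclosed hconv hPlsc hPirr hcoer hρ' hball,
    fun hPopen' _ hx => PreferenceGNEP.isEquilibrium_of_solvesVI hPopen' hx⟩
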